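/- Let $V$ and $E$ be finite-dimensional complex vector spaces, of dimensions $n$ and $r$, with Hermitian metrics whose positive $(1,1)$-forms (the negatives of the imaginary parts of the metrics) are $\omega$ and $h$. Equip $V\oplus E$ with the sum of the two metrics, and exterior forms on all these spaces with the induced Hermitian norms. Forms on $V$ and on $E$ are pulled back to $V\oplus E$ by the projections without change of notation. Let $\Lambda_\omega$ and $\Lambda_h$ be the adjoints of the operators $u\mapsto u\wedge\omega$ and $u\mapsto u\wedge h$ on forms on $V\oplus E$. Let $R\in\bigwedge^{1,1}V^*\otimes\operatorname{End}E$ be Hermitian, that is, fixed by the antilinear involution $\beta\otimes f\mapsto\overline\beta\otimes f^*$; equivalently, $R(x,y)$ is a Hermitian endomorphism of $E$ for all $x,y\in V$. View $R$ as a $(2,2)$-form on $V\oplus E$ by sending $\beta\otimes f$ to $\beta\wedge\tilde f$, where $\tilde f(x,y)=\frac i2\bigl(\langle fx,y\rangle_E-\langle fy,x\rangle_E\bigr)$ is the $(1,1)$-form on $E$ that corresponds to $f$ under the metric ($\langle\cdot,\cdot\rangle_E$ being linear in the first variable), so that the identity of $E$ corresponds to $h$. Let $c_1=\operatorname{tr}_E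 R\in\bigwedge^{1,1}V^*$. Then: 1. $|\Lambda_\omega R|^2\le n\,|R|^2$, and equality holds if and only if $R=u\wedge\omega$ for some $(1,1)$-form $u$ pulled back from $E$. 2. $\Lambda_h R$ is the pullback of $c_1$ to $V\oplus E$, and $|c_1|^2=|\Lambda_h R|^2\le r\,|R|^2$; equality holds in the last inequality if and only if $R=v\wedge h$ for some $(1,1)$-form $v$ pulled back from $V$. -/

import Mathlib

open scoped TensorProduct ComplexConjugate

set_option linter.unusedSimpArgs false

noncomputable section

namespace HermForm

/-- Complex-valued `k`-forms on (the real vector space underlying) a complex vector space `W`. -/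
abbrev Form (W : Type*) [AddCommGroup W] [Module ℂ W] (k : ℕ) : Type _ :=
  W [⋀^Fin k]→ₗ[ℝ] ℂ

section Algebra

variable {W W' : Type*} [AddCommGroup W] [Module ℂ W] [AddCommGroup W'] [Module ℂ W']

/-- The space of `(p,q)`-forms among the `k`-forms (of interest for `k = p + q`): those `u` with
`u (z w₁, …, z w_k) = z ^ p * conj z ^ q * u (w₁, …, w_k)` for all complex `z`. -/
def formsOfType (W : Type*) [AddCommGroup W] [Module ℂ W] (k p q : ℕ) :
    Submodule ℂ (Form W k) where
  carrier := {u | ∀ (z : ℂ) (w : Fin k → W), u (fun i => z • w i) = z ^ p * conj z ^ q * u w}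
  add_mem' := by
    intro a b ha hb z w
    simp only [AlternatingMap.add_apply, ha z w, hb z w]
    ring
  zero_mem' := by
    intro z w
    simp
  smul_mem' := by
    intro c a ha z w
    simp only [AlternatingMap.smul_apply, ha z w, smul_eq_mul]
    ring

/-- The space `⋀^{1,1} W^*` of `(1,1)`-forms on `W`. -/
abbrev Form11 (W : Type*) [AddCommGroup W] [Module ℂ W] : Submodule ℂ (Form W 2) :=
  formsOfType W 2 1 1

/-- The pullback of forms along a complex linear map. -/
def pullback (f : W →ₗ[ℂ] W') (k : ℕ) : Form W' k →ₗ[ℂ] Form W k where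
  toFun u := u.compLinearMap (f.restrictScalars ℝ)
  map_add' _ _ := rfl
  map_smul' _ _ := rfl

theorem pullback_apply (f : W →ₗ[ℂ] W') (k : ℕ) (u : Form W' k) (w : Fin k → W) :
    pullback f k u w = u fun i => f (w i) :=
  rfl

/-- The wedge product, with the usual normalization
`(u ∧ v)(w₁, …, w_{p+q}) = ∑_σ sign σ * u (w_σ(1), …, w_σ(p)) * v (w_σ(p+1), …, w_σ(p+q))`,
the sum being over the `(p,q)`-shuffles `σ`. -/
def wedge {p q : ℕ} (u : Form W p) (v : Form W q) : Form W (p + q) :=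
  ((LinearMap.mul' ℝ ℂ).compAlternatingMap (u.domCoprod v)).domDomCongr finSumFinEquiv

theorem wedge_apply {p q : ℕ} (u : Form W p) (v : Form W q) (w : Fin (p + q) → W) :
    wedge u v w = ((p.factorial * q.factorial : ℕ) : ℂ)⁻¹ *
      ∑ σ : Equiv.Perm (Fin p ⊕ Fin q), ((Equiv.Perm.sign σ : ℤ) : ℂ) *
        (u (fun i => w (finSumFinEquiv (σ (Sum.inl i)))) *
          v (fun i => w (finSumFinEquiv (σ (Sum.inr i))))) := by
  have h := congrArg (fun F => LinearMap.mul' ℝ ℂ (F (w ∘ finSumFinEquiv)))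
    (MultilinearMap.domCoprod_alternization_eq u v)
  simp only [Fintype.card_fin, AlternatingMap.smul_apply, map_nsmul,
    MultilinearMap.alternatization_apply, map_sum, Units.smul_def, map_zsmul,
    MultilinearMap.domDomCongr_apply, MultilinearMap.domCoprod_apply,
    AlternatingMap.coe_multilinearMap, LinearMap.mul'_apply] at h
  have hne : ((p.factorial * q.factorial : ℕ) : ℂ) ≠ 0 := by
    exact_mod_cast (Nat.mul_pos p.factorial_pos q.factorial_pos).ne'
  rw [eq_inv_mul_iff_mul_eq₀ hne]
  simpa [wedge, nsmul_eq_mul, zsmul_eq_mul] using h.symm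

theorem wedge_add_left {p q : ℕ} (u u' : Form W p) (v : Form W q) :
    wedge (u + u') v = wedge u v + wedge u' v := by
  ext w
  simp only [wedge_apply, AlternatingMap.add_apply, add_mul, mul_add, Finset.sum_add_distrib]

theorem wedge_add_right {p q : ℕ} (u : Form W p) (v v' : Form W q) :
    wedge u (v + v') = wedge u v + wedge u v' := by
  ext w
  simp only [wedge_apply, AlternatingMap.add_apply, mul_add, Finset.sum_add_distrib]

theorem wedge_smul_left {p q : ℕ} (c : ℂ) (u : Form W p) (v : Form W q) :
    wedge (c • u) v = c • wedge u v := by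
  ext w
  simp only [wedge_apply, AlternatingMap.smul_apply, smul_eq_mul, Finset.mul_sum]
  exact Finset.sum_congr rfl fun _ _ => by ring

theorem wedge_smul_right {p q : ℕ} (c : ℂ) (u : Form W p) (v : Form W q) :
    wedge u (c • v) = c • wedge u v := by
  ext w
  simp only [wedge_apply, AlternatingMap.smul_apply, smul_eq_mul, Finset.mul_sum]
  exact Finset.sum_congr rfl fun _ _ => by ring

theorem wedge_mem {k l p q p' q' : ℕ} {u : Form W k} {v : Form W l}
    (hu : u ∈ formsOfType W k p q) (hv : v ∈ formsOfType W l p' q') :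
    wedge u v ∈ formsOfType W (k + l) (p + p') (q + q') := by
  intro z w
  simp only [wedge_apply, Finset.mul_sum]
  refine Finset.sum_congr rfl fun σ _ => ?_
  have h1 : u (fun i => z • w (finSumFinEquiv (σ (Sum.inl i)))) = _ := hu z _
  have h2 : v (fun i => z • w (finSumFinEquiv (σ (Sum.inr i)))) = _ := hv z _
  rw [h1, h2]
  ring

theorem pullback_mem {k p q : ℕ} (f : W →ₗ[ℂ] W') {u : Form W' k}
    (hu : u ∈ formsOfType W' k p q) : pullback f k u ∈ formsOfType W k p q := by
  intro z w
  have h := hu z fun i => f (w i)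
  simp only [pullback_apply, map_smul]
  exact h

/-- The wedge product as a complex bilinear map. -/
def wedgeₗ (W : Type*) [AddCommGroup W] [Module ℂ W] (p q : ℕ) :
    Form W p →ₗ[ℂ] Form W q →ₗ[ℂ] Form W (p + q) :=
  LinearMap.mk₂ ℂ wedge wedge_add_left wedge_smul_left wedge_add_right wedge_smul_right

/-- The Lefschetz operator `u ↦ u ∧ η` of a `2`-form `η`. -/
def lefschetz (η : Form W 2) (k : ℕ) : Form W k →ₗ[ℂ] Form W (k + 2) :=
  (wedgeₗ W k 2).flip η

instance instFiniteDimensionalForm [FiniteDimensional ℂ W] (k : ℕ) :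
    FiniteDimensional ℂ (Form W k) := by
  have : FiniteDimensional ℝ W := FiniteDimensional.complexToReal W
  have : Module.Finite ℝ (Form W k) :=
    Module.Finite.of_injective
      (AlternatingMap.toMultilinearMapLM (R := ℝ) (S := ℝ) (M := W) (N := ℂ) (ι := Fin k))
      AlternatingMap.coe_multilinearMap_injective
  exact Module.Finite.of_restrictScalars_finite ℝ ℂ (Form W k)

end Algebra

section Metric

variable {W : Type*} [NormedAddCommGroup W] [InnerProductSpace ℂ W]

/-- The real basis `e₁, i e₁, …, eₙ, i eₙ` of `W`, where `e₁, …, eₙ` is a unitary basis; it is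
orthonormal for the Euclidean inner product underlying the Hermitian one. -/
def realFrame (W : Type*) [NormedAddCommGroup W] [InnerProductSpace ℂ W]
    [FiniteDimensional ℂ W] : Module.Basis (Fin 2 × Fin (Module.finrank ℂ W)) ℝ W :=
  Complex.basisOneI.smulTower (stdOrthonormalBasis ℂ W).toBasis

/-- The Hermitian inner product induced on `k`-forms. The forms `ε_{i₁} ∧ ⋯ ∧ ε_{i_k}` with
`i₁ < ⋯ < i_k` are orthonormal for it, where `ε` is the coframe dual to a real orthonormal frame;
the factor `1 / k!` is there because the sum is over all `k`-tuples of frame vectors. -/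
def formInner [FiniteDimensional ℂ W] {k : ℕ} (u v : Form W k) : ℂ :=
  (k.factorial : ℂ)⁻¹ *
    ∑ i : Fin k → Fin 2 × Fin (Module.finrank ℂ W),
      conj (u fun j => realFrame W (i j)) * v fun j => realFrame W (i j)

theorem formInner_self [FiniteDimensional ℂ W] {k : ℕ} (u : Form W k) :
    formInner u u = (((k.factorial : ℝ)⁻¹ *
      ∑ i : Fin k → Fin 2 × Fin (Module.finrank ℂ W),
        ‖u fun j => realFrame W (i j)‖ ^ 2 : ℝ) : ℂ) := by
  simp [formInner, Complex.conj_mul']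

/-- The properties of the inner product on forms. -/
@[reducible]
def formCore [FiniteDimensional ℂ W] (k : ℕ) : InnerProductSpace.Core ℂ (Form W k) where
  inner := formInner
  conj_inner_symm u v := by
    simp only [formInner, map_mul, map_sum, map_inv₀, Complex.conj_conj, map_natCast]
    congr 1
    exact Finset.sum_congr rfl fun _ _ => mul_comm _ _
  re_inner_nonneg u := by
    rw [formInner_self, RCLike.re_to_complex, Complex.ofReal_re]
    positivity
  add_left u v w := by
    simp only [formInner, AlternatingMap.add_apply, map_add, add_mul, Finset.sum_add_distrib,
      mul_add]
  smul_left u v c := by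
    simp only [formInner, AlternatingMap.smul_apply, smul_eq_mul, map_mul, Finset.mul_sum]
    exact Finset.sum_congr rfl fun _ _ => by ring
  definite u hu := by
    have h := formInner_self u
    rw [hu] at h
    have h0 : (k.factorial : ℝ)⁻¹ * ∑ i : Fin k → Fin 2 × Fin (Module.finrank ℂ W),
        ‖u fun j => realFrame W (i j)‖ ^ 2 = 0 := by exact_mod_cast h.symm
    have hk : (k.factorial : ℝ)⁻¹ ≠ 0 := by positivity
    have h1 := (mul_eq_zero.mp h0).resolve_left hk
    rw [Finset.sum_eq_zero_iff_of_nonneg fun _ _ => by positivity] at h1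
    refine Module.Basis.ext_alternating (realFrame W) fun i _ => ?_
    simpa using h1 i (Finset.mem_univ i)

instance instNormedAddCommGroupForm [FiniteDimensional ℂ W] (k : ℕ) :
    NormedAddCommGroup (Form W k) :=
  (formCore k).toNormedAddCommGroup

instance instInnerProductSpaceForm [FiniteDimensional ℂ W] (k : ℕ) :
    InnerProductSpace ℂ (Form W k) :=
  InnerProductSpace.ofCore (formCore k).toCore

/-- The adjoint `Λ_η` of the Lefschetz operator of `η`. -/
def lefschetzAdj [FiniteDimensional ℂ W] (η : Form W 2) (k : ℕ) :
    Form W (k + 2) →ₗ[ℂ] Form W k :=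
  LinearMap.adjoint (lefschetz η k)

/-- The form `(x, y) ↦ (i / 2) (h (f x, y) - h (f y, x))` attached to a complex endomorphism `f`,
where `h` is the Hermitian metric of `W`, linear in its first and conjugate linear in its second
variable, that is `h (x, y) = inner ℂ y x`. -/
def endForm (f : Module.End ℂ W) : Form W 2 where
  toFun w := Complex.I / 2 * (inner ℂ (w 1) (f (w 0)) - inner ℂ (w 0) (f (w 1)))
  map_update_add' := by
    intro _ w j x y
    fin_cases j <;> simp [inner_add_left, inner_add_right, Function.update] <;> ring
  map_update_smul' := by
    intro _ w j c x
    fin_cases j <;>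
      simp [inner_smul_left, inner_smul_right, Function.update, ← Complex.coe_smul] <;> ring
  map_eq_zero_of_eq' := by
    intro w i j hw hij
    have h : w 0 = w 1 := by
      fin_cases i <;> fin_cases j <;> simp_all
    simp [h]

theorem endForm_apply (f : Module.End ℂ W) (w : Fin 2 → W) :
    endForm f w = Complex.I / 2 * (inner ℂ (w 1) (f (w 0)) - inner ℂ (w 0) (f (w 1))) :=
  rfl

theorem endForm_mem (f : Module.End ℂ W) : endForm f ∈ Form11 W := by
  intro z w
  simp only [endForm_apply, map_smul, inner_smul_left, inner_smul_right]
  ring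

/-- `f ↦ endForm f` as a complex linear map; it is the isometry of `End W` onto the `(1,1)`-forms
given by the Hermitian metric, and it takes the identity to the form of the metric. -/
def endFormₗ (W : Type*) [NormedAddCommGroup W] [InnerProductSpace ℂ W] :
    Module.End ℂ W →ₗ[ℂ] Form W 2 where
  toFun := endForm
  map_add' f g := by
    ext w
    simp only [endForm_apply, AlternatingMap.add_apply, LinearMap.add_apply, inner_add_right]
    ring
  map_smul' c f := by
    ext w
    simp only [endForm_apply, AlternatingMap.smul_apply, LinearMap.smul_apply, inner_smul_right,
      RingHom.id_apply, smul_eq_mul]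
    ring

/-- The positive `(1,1)`-form `-Im h` of the Hermitian metric `h (x, y) = inner ℂ y x`. -/
def metricForm (W : Type*) [NormedAddCommGroup W] [InnerProductSpace ℂ W] : Form W 2 where
  toFun w := ((-(inner ℂ (w 1) (w 0)).im : ℝ) : ℂ)
  map_update_add' := by
    intro _ w j x y
    fin_cases j <;> simp [inner_add_left, inner_add_right, Function.update] <;> ring
  map_update_smul' := by
    intro _ w j c x
    fin_cases j <;>
      simp [inner_smul_left, inner_smul_right, Function.update, ← Complex.coe_smul, mul_comm]
  map_eq_zero_of_eq' := by
    intro w i j hw hij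
    have h : w 0 = w 1 := by
      fin_cases i <;> fin_cases j <;> simp_all
    have h' : (inner ℂ (w 1) (w 1)).im = 0 := inner_self_im (𝕜 := ℂ) (w 1)
    rw [h, h']
    simp

theorem metricForm_apply (w : Fin 2 → W) :
    metricForm W w = ((-(inner ℂ (w 1) (w 0)).im : ℝ) : ℂ) :=
  rfl

theorem endForm_one : endForm (1 : Module.End ℂ W) = metricForm W := by
  ext w
  have h := inner_conj_symm (𝕜 := ℂ) (w 0) (w 1)
  have h1 := congrArg Complex.re h
  have h2 := congrArg Complex.im h
  simp only [Complex.conj_re, Complex.conj_im] at h1 h2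
  rw [endForm_apply, metricForm_apply]
  apply Complex.ext <;> simp <;> linarith

end Metric

section Curvature

variable (V E : Type*) [NormedAddCommGroup V] [InnerProductSpace ℂ V]
  [NormedAddCommGroup E] [InnerProductSpace ℂ E]

/-- The space `⋀^{1,1} V^* ⊗ End E` of `(1,1)`-forms on `V` with values in the endomorphisms
of `E`. -/
abbrev EndForm11 : Type _ := Form11 V ⊗[ℂ] Module.End ℂ E

/-- The direct sum `V ⊕ E` with the Hermitian metric that is the sum of those of `V` and `E`. -/
abbrev Total : Type _ := WithLp 2 (V × E)

/-- The pullback of forms from `V` to `V ⊕ E`. -/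
def pullV (k : ℕ) : Form V k →ₗ[ℂ] Form (Total V E) k :=
  pullback (WithLp.fstₗ 2 ℂ V E) k

/-- The pullback of forms from `E` to `V ⊕ E`. -/
def pullE (k : ℕ) : Form E k →ₗ[ℂ] Form (Total V E) k :=
  pullback (WithLp.sndₗ 2 ℂ V E) k

variable {V E}

/-- The value `R (x, y)` of an `End E`-valued form: `(β ⊗ f) (x, y) = β (x, y) • f`. -/
def value (x y : V) : EndForm11 V E →ₗ[ℂ] Module.End ℂ E :=
  TensorProduct.lift
    { toFun := fun β => (β : Form V 2) ![x, y] • LinearMap.id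
      map_add' := fun _ _ => add_smul _ _ _
      map_smul' := fun c β => smul_smul c ((β : Form V 2) ![x, y]) LinearMap.id |>.symm }

/-- `R` is Hermitian if its values on pairs of vectors are Hermitian endomorphisms, that is if `R`
is fixed by the antilinear involution `β ⊗ f ↦ conj β ⊗ f^*`. -/
def IsHermitian (R : EndForm11 V E) : Prop :=
  ∀ x y : V, (value x y R).IsSymmetric

/-- `R` viewed as a `(2,2)`-form on `V ⊕ E`: the tensor `β ⊗ f` goes to `β ∧ endForm f`, with both
factors pulled back. -/
def toForm : EndForm11 V E →ₗ[ℂ] Form (Total V E) 4 :=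
  TensorProduct.lift
    ((wedgeₗ (Total V E) 2 2).compl₁₂ (pullV V E 2 ∘ₗ (Form11 V).subtype)
      (pullE V E 2 ∘ₗ endFormₗ E))

theorem toForm_tmul (β : Form11 V) (f : Module.End ℂ E) :
    toForm (β ⊗ₜ[ℂ] f) = wedge (pullV V E 2 β) (pullE V E 2 (endForm f)) :=
  rfl

theorem toForm_mem (R : EndForm11 V E) : toForm R ∈ formsOfType (Total V E) 4 2 2 := by
  induction R using TensorProduct.induction_on with
  | zero => rw [map_zero]; exact Submodule.zero_mem _
  | tmul β f => exact wedge_mem (pullback_mem _ β.2) (pullback_mem _ (endForm_mem f))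
  | add x y hx hy => rw [map_add]; exact Submodule.add_mem _ hx hy

/-- The first Chern form `c₁ = tr_E R`, a form on `V`: the tensor `β ⊗ f` goes to `(tr f) β`. -/
def chernOne : EndForm11 V E →ₗ[ℂ] Form V 2 :=
  TensorProduct.lift
    ((LinearMap.lsmul ℂ (Form V 2)).flip.compl₁₂ (Form11 V).subtype (LinearMap.trace ℂ E))

variable (V E) in
/-- The form `ω` of the metric of `V`, pulled back to `V ⊕ E`. -/
def omegaV : Form (Total V E) 2 := pullV V E 2 (metricForm V)

variable (V E) in
/-- The form `h` of the metric of `E`, pulled back to `V ⊕ E`. -/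
def hE : Form (Total V E) 2 := pullE V E 2 (metricForm E)

end Curvature

end HermForm

end

/-! Both estimates are one Hilbert space fact. Let `L` be wedging with ω, and let `S` be the space
of (1,1)-forms pulled back from `E`. Two inputs are needed: `L* L = n` on `S`, and `L* R ∈ S`. They
give `‖n R - L L* R‖² = n (n ‖R‖² - ‖L* R‖²)`, so the inequality holds, and for `n > 0` equality
forces `R = L (L* R / n)`. This is `norm_adjoint_sq_le`. Exchanging `V` with `E` and ω with `h`
gives the second estimate.

Both inputs come from one contraction formula: `Λ_ω (ψ ∧ β) = ⟨ω, β⟩ ψ` for ψ pulled back from `E`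
and β from `V`, and symmetrically for `Λ_h` (`IsParseval.lefschetzAdj_wedge`). It is proved by
evaluating the inner product in a frame adapted to `V ⊕ E`. The identity `⟨h, f̃⟩ = tr f`
(`inner_metricForm_endForm`) then identifies `Λ_h R` with `c₁`, and `f = 1` gives the constants `n`
and `r`. -/

noncomputable section

namespace HermForm

/-! ### Wedge products of two 2-forms -/

section Wedge
variable {W : Type*} [AddCommGroup W] [Module ℂ W]

theorem form_two_apply (u : Form W 2) (w : Fin 2 → W) : u w = u ![w 0, w 1] := by
  congr 1
  ext i
  fin_cases i <;> rfl

theorem form_two_zero_left (u : Form W 2) (x : W) : u ![0, x] = 0 :=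
  u.map_coord_zero 0 rfl

theorem form_two_zero_right (u : Form W 2) (x : W) : u ![x, 0] = 0 :=
  u.map_coord_zero 1 rfl

theorem form_two_swap (u : Form W 2) (x y : W) : u ![y, x] = -u ![x, y] := by
  have h := u.map_swap ![x, y] (i := 0) (j := 1) (by decide)
  rw [← h]
  congr 1
  ext i
  fin_cases i <;> rfl

/-- An enumeration of the permutations of four letters. -/
def permFinFour (x : Fin 4 × Fin 3 × Fin 2) : Equiv.Perm (Fin 4) :=
  Equiv.swap 0 x.1 * Equiv.swap 1 x.2.1.succ * Equiv.swap 2 x.2.2.succ.succ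

set_option maxRecDepth 10000 in
theorem permFinFour_bijective : Function.Bijective permFinFour := by
  rw [Fintype.bijective_iff_injective_and_card]
  refine ⟨by unfold Function.Injective; decide, by decide⟩

theorem wedge_two_two_apply (u v : Form W 2) (w : Fin (2 + 2) → W) :
    wedge u v w =
      u ![w 0, w 1] * v ![w 2, w 3] - u ![w 0, w 2] * v ![w 1, w 3]
      + u ![w 0, w 3] * v ![w 1, w 2] + u ![w 1, w 2] * v ![w 0, w 3]
      - u ![w 1, w 3] * v ![w 0, w 2] + u ![w 2, w 3] * v ![w 0, w 1] := by
  -- Recording the values in arrays indexed by `Fin 4` leaves only numerals, so the 24 terms of the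
  -- sum over permutations can be computed.
  obtain ⟨U, hU⟩ : ∃ U : Fin 4 → Fin 4 → ℂ, ∀ a b, u ![w a, w b] = U a b := ⟨_, fun _ _ => rfl⟩
  obtain ⟨V, hV⟩ : ∃ V : Fin 4 → Fin 4 → ℂ, ∀ a b, v ![w a, w b] = V a b := ⟨_, fun _ _ => rfl⟩
  have hU' (f : Fin 2 → Fin 4) : u (fun i => w (f i)) = U (f 0) (f 1) := by
    rw [form_two_apply, hU]
  have hV' (f : Fin 2 → Fin 4) : v (fun i => w (f i)) = V (f 0) (f 1) := by
    rw [form_two_apply, hV]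
  have hUs (a b : Fin 4) : U b a = -U a b := by rw [← hU, ← hU, form_two_swap]
  have hVs (a b : Fin 4) : V b a = -V a b := by rw [← hV, ← hV, form_two_swap]
  simp only [hU, hV]
  rw [wedge_apply, ← (finSumFinEquiv (m := 2) (n := 2)).symm.permCongr.sum_comp]
  simp only [Equiv.Perm.sign_permCongr, Equiv.permCongr_apply, Equiv.symm_symm,
    Equiv.apply_symm_apply, hU' fun _ => _, hV' fun _ => _]
  have e0 : finSumFinEquiv (Sum.inl 0 : Fin 2 ⊕ Fin 2) = (0 : Fin 4) := rfl
  have e1 : finSumFinEquiv (Sum.inl 1 : Fin 2 ⊕ Fin 2) = (1 : Fin 4) := rfl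
  have e2 : finSumFinEquiv (Sum.inr 0 : Fin 2 ⊕ Fin 2) = (2 : Fin 4) := rfl
  have e3 : finSumFinEquiv (Sum.inr 1 : Fin 2 ⊕ Fin 2) = (3 : Fin 4) := rfl
  simp only [e0, e1, e2, e3]
  change _ * ∑ σ : Equiv.Perm (Fin 4),
    ((Equiv.Perm.sign σ : ℤ) : ℂ) * (U (σ 0) (σ 1) * V (σ 2) (σ 3)) = _
  rw [← permFinFour_bijective.sum_comp fun σ : Equiv.Perm (Fin 4) =>
    ((Equiv.Perm.sign σ : ℤ) : ℂ) * (U (σ 0) (σ 1) * V (σ 2) (σ 3))]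
  simp only [Fintype.sum_prod_type, Fin.sum_univ_four, Fin.sum_univ_three, Fin.sum_univ_two,
    permFinFour, Equiv.Perm.sign_mul, Equiv.Perm.mul_apply, Equiv.swap_apply_def]
  simp [Equiv.Perm.sign_swap']
  rw [hUs 0 1, hUs 0 2, hUs 0 3, hUs 1 2, hUs 1 3, hUs 2 3,
    hVs 0 1, hVs 0 2, hVs 0 3, hVs 1 2, hVs 1 3, hVs 2 3]
  ring

theorem wedge_two_two_comm (u v : Form W 2) : wedge u v = wedge v u := by
  ext w
  rw [wedge_two_two_apply, wedge_two_two_apply]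
  ring

end Wedge

/-! ### Inner products of forms in arbitrary Parseval frames -/

section Parseval
variable {W : Type*} [NormedAddCommGroup W] [InnerProductSpace ℂ W]

/-- A finite family `e` such that `x = ∑ a, Re ⟪e a, x⟫ • e a` for all `x`. -/
def IsParseval {ι : Type*} [Fintype ι] (e : ι → W) : Prop :=
  ∀ x : W, ∑ a, (inner ℂ (e a) x).re • e a = x

theorem IsParseval.form_eq_sum {ι : Type*} [Fintype ι] {e : ι → W} (he : IsParseval e)
    {k : ℕ} (u : Form W k) (w : Fin k → W) :
    u w = ∑ i : Fin k → ι, ((∏ j, (inner ℂ (e (i j)) (w j)).re : ℝ) : ℂ) * u fun j => e (i j) := by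
  classical
  conv_lhs => rw [← funext fun j => he (w j)]
  have h := u.toMultilinearMap.map_sum fun (j : Fin k) (a : ι) => (inner ℂ (e a) (w j)).re • e a
  simp only [AlternatingMap.coe_multilinearMap] at h
  rw [h]
  refine Finset.sum_congr rfl fun i _ => ?_
  rw [← Complex.real_smul]
  exact u.toMultilinearMap.map_smul_univ _ _

/-- Expanding `v` along `f` produces real coefficients that are symmetric in `e` and `f`; after
exchanging the sums, the same coefficients expand `u` along `e`. Hence the inner product of forms
does not depend on the frame. -/
theorem IsParseval.sum_eq_sum {ι κ : Type*} [Fintype ι] [Fintype κ] {e : ι → W} {f : κ → W}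
    (he : IsParseval e) (hf : IsParseval f) {k : ℕ} (u v : Form W k) :
    ∑ i : Fin k → ι, conj (u fun j => e (i j)) * v (fun j => e (i j)) =
      ∑ i : Fin k → κ, conj (u fun j => f (i j)) * v (fun j => f (i j)) := by
  calc _ = ∑ i : Fin k → ι, ∑ q : Fin k → κ, conj (u fun j => e (i j)) *
        (((∏ j, (inner ℂ (f (q j)) (e (i j))).re : ℝ) : ℂ) * v fun j => f (q j)) := by
        refine Finset.sum_congr rfl fun i _ => ?_
        rw [hf.form_eq_sum v, Finset.mul_sum]
    _ = _ := by
        rw [Finset.sum_comm]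
        refine Finset.sum_congr rfl fun q _ => ?_
        rw [he.form_eq_sum u fun j => f (q j), map_sum, Finset.sum_mul]
        refine Finset.sum_congr rfl fun i _ => ?_
        rw [map_mul, Complex.conj_ofReal]
        have : ∀ j, (inner ℂ (f (q j)) (e (i j))).re = (inner ℂ (e (i j)) (f (q j))).re :=
          fun j => inner_re_symm (𝕜 := ℂ) _ _
        simp only [this]
        ring

theorem isParseval_realFrame [FiniteDimensional ℂ W] : IsParseval (realFrame W) := by
  intro x
  rw [Fintype.sum_prod_type, Fin.sum_univ_two, ← Finset.sum_add_distrib]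
  conv_rhs => rw [← (stdOrthonormalBasis ℂ W).sum_repr' x]
  refine Finset.sum_congr rfl fun j _ => ?_
  simp only [realFrame, Module.Basis.smulTower_apply, Complex.coe_basisOneI, Matrix.cons_val_zero,
    Matrix.cons_val_one, one_smul, OrthonormalBasis.coe_toBasis, inner_smul_left, Complex.conj_I]
  rw [← Complex.coe_smul, ← Complex.coe_smul, smul_smul, ← add_smul]
  congr 1
  apply Complex.ext <;> simp

variable [FiniteDimensional ℂ W]

theorem IsParseval.formInner_eq {ι : Type*} [Fintype ι] {e : ι → W} (he : IsParseval e)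
    {k : ℕ} (u v : Form W k) :
    formInner u v = (k.factorial : ℂ)⁻¹ *
      ∑ i : Fin k → ι, conj (u fun j => e (i j)) * v fun j => e (i j) := by
  rw [formInner, isParseval_realFrame.sum_eq_sum he]

theorem inner_eq_formInner {k : ℕ} (u v : Form W k) : inner ℂ u v = formInner u v := rfl

/-- Since `x` is alternating, reindexing the frame tuples by a permutation absorbs its sign. All
`(p+q)!` terms of the wedge product therefore contribute equally, which cancels the factorial in the
norm. -/
theorem IsParseval.formInner_wedge {ι : Type*} [Fintype ι] {e : ι → W} (he : IsParseval e)
    {p q : ℕ} (u : Form W p) (v : Form W q) (x : Form W (p + q)) :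
    formInner (wedge u v) x = ((p.factorial * q.factorial : ℕ) : ℂ)⁻¹ *
      ∑ i : Fin p ⊕ Fin q → ι, conj (u fun j => e (i (Sum.inl j))) *
        conj (v fun j => e (i (Sum.inr j))) * x fun j => e (i (finSumFinEquiv.symm j)) := by
  classical
  have hx (σ : Equiv.Perm (Fin p ⊕ Fin q)) (i : Fin p ⊕ Fin q → ι) :
      x (fun j => e (i (σ (finSumFinEquiv.symm j)))) =
        ((Equiv.Perm.sign σ : ℤ) : ℂ) * x (fun j => e (i (finSumFinEquiv.symm j))) := by
    have h := x.map_perm (fun j => e (i (finSumFinEquiv.symm j)))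
      (finSumFinEquiv.permCongr σ)
    rw [Equiv.Perm.sign_permCongr, Units.smul_def, zsmul_eq_mul] at h
    rw [← h]
    simp [Function.comp_def, Equiv.permCongr_apply]
  rw [he.formInner_eq]
  have key (σ : Equiv.Perm (Fin p ⊕ Fin q)) :
      ∑ i : Fin (p + q) → ι, ((Equiv.Perm.sign σ : ℤ) : ℂ) *
        (conj (u fun j => e (i (finSumFinEquiv (σ (Sum.inl j))))) *
        conj (v fun j => e (i (finSumFinEquiv (σ (Sum.inr j)))))) * x (fun j => e (i j)) =
      ∑ i : Fin p ⊕ Fin q → ι, conj (u fun j => e (i (Sum.inl j))) *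
        conj (v fun j => e (i (Sum.inr j))) * x fun j => e (i (finSumFinEquiv.symm j)) := by
    let φ : (Fin (p + q) → ι) ≃ (Fin p ⊕ Fin q → ι) :=
      Equiv.arrowCongr ((σ.trans finSumFinEquiv).symm) (Equiv.refl ι)
    refine Fintype.sum_equiv φ _ _ fun i => ?_
    have h := hx σ⁻¹ (fun j => φ i (σ⁻¹ j))
    have h2 := hx σ (fun j => i (finSumFinEquiv j))
    simp only [φ, Equiv.arrowCongr_apply, Equiv.symm_symm, Function.comp_apply,
      Equiv.coe_refl, id, Equiv.coe_trans, Equiv.apply_symm_apply] at h2 ⊢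
    rw [h2]
    ring
  have hsum (i : Fin (p + q) → ι) :
      conj (wedge u v fun j => e (i j)) * x (fun j => e (i j)) =
        ((p.factorial * q.factorial : ℕ) : ℂ)⁻¹ *
          ∑ σ : Equiv.Perm (Fin p ⊕ Fin q), ((Equiv.Perm.sign σ : ℤ) : ℂ) *
            (conj (u fun j => e (i (finSumFinEquiv (σ (Sum.inl j))))) *
            conj (v fun j => e (i (finSumFinEquiv (σ (Sum.inr j)))))) * x (fun j => e (i j)) := by
    simp only [wedge_apply, map_mul, map_inv₀, map_natCast, map_sum, map_intCast, Finset.sum_mul,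
      mul_assoc]
  simp only [hsum]
  rw [← Finset.mul_sum, Finset.sum_comm, Finset.sum_congr rfl fun σ _ => key σ, Finset.sum_const,
    Finset.card_univ, Fintype.card_perm, Fintype.card_sum, Fintype.card_fin, Fintype.card_fin,
    nsmul_eq_mul, mul_left_comm, inv_mul_cancel_left₀]
  exact_mod_cast (p + q).factorial_ne_zero

end Parseval

/-! ### Contraction by the adjoint Lefschetz operator -/

section Adjoint
variable {W : Type*} [NormedAddCommGroup W] [InnerProductSpace ℂ W] [FiniteDimensional ℂ W]

/-- The hypothesis on frame vectors says that η and ψ live on complementary directions, so η selects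
the arguments that go to β. As `u` is arbitrary, this computes the adjoint of `u ↦ u ∧ η` on `ψ ∧
β`. -/
theorem IsParseval.formInner_wedge_wedge {ι : Type*} [Fintype ι] {e : ι → W} (he : IsParseval e)
    {η ψ : Form W 2}
    (h : ∀ a, (∀ x, η ![e a, x] = 0) ∨ ∀ x, ψ ![x, e a] = 0) (u β : Form W 2) :
    formInner (wedge u η) (wedge ψ β) = formInner η β * formInner u ψ := by
  have hval (l r : Fin 2 → ι) :
      conj (η fun j => e (r j)) * wedge ψ β (fun j => e (Sum.elim l r (finSumFinEquiv.symm j))) =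
        conj (η fun j => e (r j)) * ((ψ fun j => e (l j)) * β fun j => e (r j)) := by
    have e0 : finSumFinEquiv.symm (0 : Fin (2 + 2)) = Sum.inl 0 := rfl
    have e1 : finSumFinEquiv.symm (1 : Fin (2 + 2)) = Sum.inl 1 := rfl
    have e2 : finSumFinEquiv.symm (2 : Fin (2 + 2)) = Sum.inr 0 := rfl
    have e3 : finSumFinEquiv.symm (3 : Fin (2 + 2)) = Sum.inr 1 := rfl
    rw [wedge_two_two_apply, e0, e1, e2, e3]
    simp only [Sum.elim_inl, Sum.elim_inr]
    rw [form_two_apply η fun j => e (r j), form_two_apply ψ fun j => e (l j),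
      form_two_apply β fun j => e (r j)]
    -- If η kills `e (r 0)` or `e (r 1)`, both sides vanish. Otherwise ψ kills both, and each of the
    -- other five shuffles feeds ψ one of them.
    rcases h (r 0) with h0 | h0
    · simp [h0]
    rcases h (r 1) with h1 | h1
    · simp [form_two_swap η (e (r 1)) (e (r 0)), h1]
    · simp [h0, h1]
  rw [he.formInner_wedge, he.formInner_eq, he.formInner_eq,
    ← (Equiv.sumArrowEquivProdArrow _ _ ι).symm.sum_comp, Fintype.sum_prod_type_right]
  simp only [Equiv.sumArrowEquivProdArrow_symm_apply_inl,
    Equiv.sumArrowEquivProdArrow_symm_apply_inr]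
  have hterm (l r : Fin 2 → ι) :
      conj (u fun j => e (l j)) * conj (η fun j => e (r j)) *
        wedge ψ β (fun j => e ((Equiv.sumArrowEquivProdArrow _ _ ι).symm (l, r)
          (finSumFinEquiv.symm j))) =
      conj (η fun j => e (r j)) * β (fun j => e (r j)) *
        (conj (u fun j => e (l j)) * ψ fun j => e (l j)) := by
    have h := hval l r
    rw [mul_assoc]
    refine (congrArg _ h).trans ?_
    ring
  simp only [hterm, ← Finset.mul_sum, ← Finset.sum_mul]
  push_cast
  ring

theorem IsParseval.lefschetzAdj_wedge {ι : Type*} [Fintype ι] {e : ι → W} (he : IsParseval e)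
    {η ψ : Form W 2}
    (h : ∀ a, (∀ x, η ![e a, x] = 0) ∨ ∀ x, ψ ![x, e a] = 0) (β : Form W 2) :
    lefschetzAdj η 2 (wedge ψ β) = inner ℂ η β • ψ := by
  refine ext_inner_left ℂ fun u => ?_
  rw [inner_smul_right]
  exact (LinearMap.adjoint_inner_right _ _ _).trans (he.formInner_wedge_wedge h u β)

/-- In the frame `e_j, i e_j` the metric form pairs only `e_j` with `i e_j`, where `endForm f` takes
the value `⟨f e_j, e_j⟩`. The two orders of each pair offset the factor `1 / 2!`. -/
theorem inner_metricForm_endForm (f : Module.End ℂ W) :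
    inner ℂ (metricForm W) (endForm f) = LinearMap.trace ℂ W f := by
  rw [inner_eq_formInner, formInner, ← (finTwoArrowEquiv _).symm.sum_comp]
  rw [LinearMap.trace_eq_sum_inner f (stdOrthonormalBasis ℂ W)]
  have hm (s t : Fin 2) (i j) : metricForm W ![realFrame W (s, i), realFrame W (t, j)] =
     if i = j then (if s = 0 ∧ t = 1 then 1 else if s = 1 ∧ t = 0 then -1 else 0) else 0 := by
    have hb := (stdOrthonormalBasis ℂ W).inner_eq_ite j i
    simp only [metricForm_apply, realFrame, Module.Basis.smulTower_apply, Complex.coe_basisOneI,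
      OrthonormalBasis.coe_toBasis, inner_smul_left, inner_smul_right, Matrix.cons_val_zero,
      Matrix.cons_val_one, hb]
    rcases eq_or_ne i j with rfl | hij
    · fin_cases s <;> fin_cases t <;> simp
    · simp [hij, hij.symm]
  have he (j) : endForm f ![realFrame W (0, j), realFrame W (1, j)] =
      inner ℂ (stdOrthonormalBasis ℂ W j) (f (stdOrthonormalBasis ℂ W j)) := by
    simp only [endForm_apply, realFrame, Module.Basis.smulTower_apply, Complex.coe_basisOneI,
      OrthonormalBasis.coe_toBasis, inner_smul_left, inner_smul_right, Matrix.cons_val_zero,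
      Matrix.cons_val_one, map_smul, one_smul, Complex.conj_I]
    linear_combination (-inner ℂ (stdOrthonormalBasis ℂ W j) (f (stdOrthonormalBasis ℂ W j))) *
      Complex.I_mul_I
  have hc (a : Fin 2 → Fin 2 × Fin (Module.finrank ℂ W)) :
      (fun j => realFrame W (a j)) = ![realFrame W (a 0), realFrame W (a 1)] := by
    ext i; fin_cases i <;> rfl
  simp only [hc, finTwoArrowEquiv_symm_apply, Matrix.cons_val_zero, Matrix.cons_val_one,
    Fintype.sum_prod_type, Fin.sum_univ_two, hm]
  simp only [apply_ite conj, map_zero, map_one, map_neg, ite_mul, zero_mul, Finset.sum_ite_eq,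
    Finset.mem_univ, if_true]
  simp [form_two_swap (endForm f) (realFrame W (0, _)) (realFrame W (1, _)), he]
  ring

theorem inner_metricForm_self :
    inner ℂ (metricForm W) (metricForm W) = (Module.finrank ℂ W : ℂ) := by
  have h := inner_metricForm_endForm (1 : Module.End ℂ W)
  rwa [endForm_one, LinearMap.trace_one] at h

end Adjoint

/-! ### Forms on the direct sum and their contractions -/

section Total
variable {V E : Type*} [NormedAddCommGroup V] [InnerProductSpace ℂ V]
  [NormedAddCommGroup E] [InnerProductSpace ℂ E]

/-- A map whose adjoint is a right inverse sends Parseval frames to Parseval frames, though not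
bases to bases. Applied to the projections of `V ⊕ E`, this makes pullback of forms isometric. -/
theorem IsParseval.map {W W' : Type*} [NormedAddCommGroup W] [InnerProductSpace ℂ W]
    [NormedAddCommGroup W'] [InnerProductSpace ℂ W'] {ι : Type*} [Fintype ι] {e : ι → W}
    (he : IsParseval e) (f : W →ₗ[ℂ] W') (g : W' → W) (hfg : ∀ x, f (g x) = x)
    (hadj : ∀ x y, inner ℂ (f x) y = inner ℂ x (g y)) : IsParseval fun a => f (e a) := by
  intro x
  have h := congrArg f (he (g x))
  rw [hfg, map_sum] at h
  conv_rhs => rw [← h]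
  refine Finset.sum_congr rfl fun a _ => ?_
  rw [hadj, ← Complex.coe_smul, ← Complex.coe_smul, map_smul]

theorem IsParseval.sumElim {ι κ : Type*} [Fintype ι] [Fintype κ] {e : ι → V} {f : κ → E}
    (he : IsParseval e) (hf : IsParseval f) :
    IsParseval (W := Total V E) (Sum.elim (fun a => WithLp.toLp 2 (e a, 0))
      fun b => WithLp.toLp 2 (0, f b)) := by
  intro x
  have h1 := he x.fst
  have h2 := hf x.snd
  simp only [Fintype.sum_sum_type, Sum.elim_inl, Sum.elim_inr, WithLp.prod_inner_apply,
    inner_zero_left, add_zero, zero_add]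
  simp only [← Complex.coe_smul] at h1 h2 ⊢
  apply WithLp.ofLp_injective 2
  refine Prod.ext ?_ ?_
  · refine (map_add (WithLp.fstₗ 2 ℂ V E) _ _).trans ?_
    simpa [map_sum] using h1
  · refine (map_add (WithLp.sndₗ 2 ℂ V E) _ _).trans ?_
    simpa [map_sum] using h2

theorem pullV_two_apply (u : Form V 2) (x y : Total V E) :
    pullV V E 2 u ![x, y] = u ![x.fst, y.fst] := by
  rw [pullV, pullback_apply, form_two_apply]; rfl

theorem pullE_two_apply (u : Form E 2) (x y : Total V E) :
    pullE V E 2 u ![x, y] = u ![x.snd, y.snd] := by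
  rw [pullE, pullback_apply, form_two_apply]; rfl

theorem chernOne_mem (R : EndForm11 V E) : chernOne R ∈ Form11 V := by
  induction R using TensorProduct.induction_on with
  | zero => rw [map_zero]; exact Submodule.zero_mem _
  | tmul β f => exact Submodule.smul_mem _ (LinearMap.trace ℂ E f) β.2
  | add x y hx hy => rw [map_add]; exact Submodule.add_mem _ hx hy

variable [FiniteDimensional ℂ V] [FiniteDimensional ℂ E]

theorem inner_pullV (k : ℕ) (u v : Form V k) :
    inner ℂ (pullV V E k u) (pullV V E k v) = inner ℂ u v := by
  have hp : IsParseval fun a => WithLp.fstₗ 2 ℂ V E (realFrame (Total V E) a) :=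
    isParseval_realFrame.map _ (fun x => WithLp.toLp 2 (x, 0)) (fun _ => rfl) (by
      intro x y; simp [WithLp.prod_inner_apply])
  rw [inner_eq_formInner, inner_eq_formInner, hp.formInner_eq]
  rfl

theorem inner_pullE (k : ℕ) (u v : Form E k) :
    inner ℂ (pullE V E k u) (pullE V E k v) = inner ℂ u v := by
  have hp : IsParseval fun a => WithLp.sndₗ 2 ℂ V E (realFrame (Total V E) a) :=
    isParseval_realFrame.map _ (fun x => WithLp.toLp 2 (0, x)) (fun _ => rfl) (by
      intro x y; simp [WithLp.prod_inner_apply])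
  rw [inner_eq_formInner, inner_eq_formInner, hp.formInner_eq]
  rfl

theorem exists_isParseval_total : ∃ e : (Fin 2 × Fin (Module.finrank ℂ V)) ⊕
    (Fin 2 × Fin (Module.finrank ℂ E)) → Total V E,
    IsParseval e ∧ ∀ a, (e a).fst = 0 ∨ (e a).snd = 0 :=
  ⟨_, isParseval_realFrame.sumElim isParseval_realFrame, by rintro (a | a) <;> simp⟩

theorem lefschetzAdj_omegaV_wedge (ψ : Form E 2) (β : Form V 2) :
    lefschetzAdj (omegaV V E) 2 (wedge (pullE V E 2 ψ) (pullV V E 2 β)) =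
      inner ℂ (metricForm V) β • pullE V E 2 ψ := by
  obtain ⟨e, he, h⟩ := exists_isParseval_total (V := V) (E := E)
  rw [← inner_pullV (E := E), ← omegaV]
  refine he.lefschetzAdj_wedge (fun a => (h a).imp (fun ha x => ?_) fun ha x => ?_) _
  · rw [omegaV, pullV_two_apply, ha, form_two_zero_left]
  · rw [pullE_two_apply, ha, form_two_zero_right]

theorem lefschetzAdj_hE_wedge (β : Form V 2) (ψ : Form E 2) :
    lefschetzAdj (hE V E) 2 (wedge (pullV V E 2 β) (pullE V E 2 ψ)) =
      inner ℂ (metricForm E) ψ • pullV V E 2 β := by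
  obtain ⟨e, he, h⟩ := exists_isParseval_total (V := V) (E := E)
  rw [← inner_pullE (V := V), ← hE]
  refine he.lefschetzAdj_wedge (fun a => (h a).symm.imp (fun ha x => ?_) fun ha x => ?_) _
  · rw [hE, pullE_two_apply, ha, form_two_zero_left]
  · rw [pullV_two_apply, ha, form_two_zero_right]

theorem lefschetzAdj_hE_toForm (R : EndForm11 V E) :
    lefschetzAdj (hE V E) 2 (toForm R) = pullV V E 2 (chernOne R) := by
  induction R using TensorProduct.induction_on with
  | zero => simp only [map_zero]
  | tmul β f =>
    rw [toForm_tmul, lefschetzAdj_hE_wedge, inner_metricForm_endForm, ← map_smul]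
    rfl
  | add x y hx hy => simp only [map_add, hx, hy]

/-- Supplies the condition `L* T ∈ S` of `norm_adjoint_sq_le` for the contraction with ω. -/
theorem exists_lefschetzAdj_omegaV_toForm (R : EndForm11 V E) :
    ∃ u ∈ Form11 E, lefschetzAdj (omegaV V E) 2 (toForm R) = pullE V E 2 u := by
  induction R using TensorProduct.induction_on with
  | zero => exact ⟨0, Submodule.zero_mem _, by simp only [map_zero]⟩
  | tmul β f =>
    refine ⟨inner ℂ (metricForm V) (β : Form V 2) • endForm f,
      Submodule.smul_mem _ _ (endForm_mem f), ?_⟩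
    -- The contraction formula wants the factor from `V` last; 2-forms commute, so no sign appears.
    rw [toForm_tmul, wedge_two_two_comm, lefschetzAdj_omegaV_wedge, map_smul]
  | add x y hx hy =>
    obtain ⟨u, hu, hxu⟩ := hx
    obtain ⟨v, hv, hyv⟩ := hy
    exact ⟨u + v, Submodule.add_mem _ hu hv, by simp only [map_add, hxu, hyv]⟩

end Total

/-! ### The Hilbert space estimate -/

section Estimate

/-- If `L* L = m` on a submodule `S` and `L* T ∈ S`, then `‖L* T‖² ≤ m ‖T‖²`, with equality
exactly for `T` in the image of `S`. -/
theorem norm_adjoint_sq_le {F G : Type*} [NormedAddCommGroup F] [InnerProductSpace ℂ F]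
    [FiniteDimensional ℂ F] [NormedAddCommGroup G] [InnerProductSpace ℂ G] [FiniteDimensional ℂ G]
    (L : F →ₗ[ℂ] G) (S : Submodule ℂ F) (m : ℕ) (hL : ∀ s ∈ S, L.adjoint (L s) = (m : ℂ) • s)
    (T : G) (hT : L.adjoint T ∈ S) (hT0 : m = 0 → T = 0) :
    ‖L.adjoint T‖ ^ 2 ≤ (m : ℝ) * ‖T‖ ^ 2 ∧
      (‖L.adjoint T‖ ^ 2 = (m : ℝ) * ‖T‖ ^ 2 ↔ ∃ s ∈ S, T = L s) := by
  have hLs : ∀ s ∈ S, ‖L s‖ ^ 2 = m * ‖s‖ ^ 2 := by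
    intro s hs
    have h := L.adjoint_inner_right s (L s)
    rw [hL s hs, inner_smul_right, inner_self_eq_norm_sq_to_K, inner_self_eq_norm_sq_to_K] at h
    have h2 : ((‖L s‖ ^ 2 : ℝ) : ℂ) = ((m * ‖s‖ ^ 2 : ℝ) : ℂ) := by
      push_cast
      exact h.symm
    exact Complex.ofReal_injective h2
  -- For `m = 0` the equality case would be empty of content, and `T = 0` has to come from `hT0`.
  rcases Nat.eq_zero_or_pos m with hm | hm
  · have : T = 0 := hT0 hm
    subst this
    simp only [map_zero, norm_zero]
    exact ⟨by simp, fun _ => ⟨0, S.zero_mem, (map_zero L).symm⟩, fun _ => by simp⟩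
  have hm' : (0 : ℝ) < m := by exact_mod_cast hm
  -- Expand the square: the cross term is `m ‖L* T‖²` by adjointness, and `‖L L* T‖² = m ‖L* T‖²`
  -- because `L* T ∈ S`.
  have key : ‖(m : ℂ) • T - L (L.adjoint T)‖ ^ 2 =
      m * (m * ‖T‖ ^ 2 - ‖L.adjoint T‖ ^ 2) := by
    rw [norm_sub_sq (𝕜 := ℂ), hLs _ hT, norm_smul, ← L.adjoint_inner_left, map_smul,
      inner_smul_left, inner_self_eq_norm_sq_to_K]
    have : (RCLike.re (conj (m : ℂ) * ((‖L.adjoint T‖ : ℝ) : ℂ) ^ 2) : ℝ) =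
        m * ‖L.adjoint T‖ ^ 2 := by
      rw [map_natCast]
      have h : (m : ℂ) * ((‖L.adjoint T‖ : ℝ) : ℂ) ^ 2 =
        ((m * ‖L.adjoint T‖ ^ 2 : ℝ) : ℂ) := by push_cast; rfl
      rw [h]
      exact Complex.ofReal_re _
    refine (congrArg (fun t => _ - 2 * t + _) this).trans ?_
    rw [Complex.norm_natCast]
    ring
  refine ⟨?_, fun h => ?_, ?_⟩
  · have h : 0 ≤ (m : ℝ) * (m * ‖T‖ ^ 2 - ‖L.adjoint T‖ ^ 2) := key ▸ sq_nonneg _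
    linarith [nonneg_of_mul_nonneg_right h hm']
  · rw [h, sub_self, mul_zero, sq_eq_zero_iff, norm_eq_zero, sub_eq_zero] at key
    refine ⟨(m : ℂ)⁻¹ • L.adjoint T, S.smul_mem _ hT, ?_⟩
    rw [map_smul, ← key, inv_smul_smul₀ (by exact_mod_cast hm.ne')]
  · rintro ⟨s, hs, rfl⟩
    rw [hL s hs, hLs s hs, norm_smul, Complex.norm_natCast]
    ring

end Estimate

/-! ### The degenerate cases `n = 0` and `r = 0` -/

section Vanishing
variable {V E : Type*} [NormedAddCommGroup V] [InnerProductSpace ℂ V]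
  [NormedAddCommGroup E] [InnerProductSpace ℂ E]

theorem toForm_eq_zero_of_subsingleton_left [Subsingleton V] (R : EndForm11 V E) :
    toForm R = 0 := by
  have h : Subsingleton (Form11 V) := ⟨fun a b => by
    apply Subtype.ext
    ext w
    rw [Subsingleton.elim w 0]
    exact (AlternatingMap.map_zero _).trans (AlternatingMap.map_zero _).symm⟩
  induction R using TensorProduct.induction_on with
  | zero => exact map_zero _
  | tmul β f => rw [Subsingleton.elim β 0, TensorProduct.zero_tmul, map_zero]
  | add x y hx hy => rw [map_add, hx, hy, add_zero]

theorem toForm_eq_zero_of_subsingleton_right [Subsingleton E] (R : EndForm11 V E) :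
    toForm R = 0 := by
  induction R using TensorProduct.induction_on with
  | zero => exact map_zero _
  | tmul β f => rw [Subsingleton.elim f 0, TensorProduct.tmul_zero, map_zero]
  | add x y hx hy => rw [map_add, hx, hy, add_zero]

end Vanishing

end HermForm

end

/-! ### The two estimates and their equality cases -/

theorem mainTheorem6 {V E : Type*}
    [NormedAddCommGroup V] [InnerProductSpace ℂ V] [FiniteDimensional ℂ V]
    [NormedAddCommGroup E] [InnerProductSpace ℂ E] [FiniteDimensional ℂ E]
    (R : HermForm.EndForm11 V E) (hR : HermForm.IsHermitian R) :
    -- the estimate for `Λ_ω R`, with its equality case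
    (‖HermForm.lefschetzAdj (HermForm.omegaV V E) 2 (HermForm.toForm R)‖ ^ 2 ≤
        (Module.finrank ℂ V : ℝ) * ‖HermForm.toForm R‖ ^ 2 ∧
      (‖HermForm.lefschetzAdj (HermForm.omegaV V E) 2 (HermForm.toForm R)‖ ^ 2 =
          (Module.finrank ℂ V : ℝ) * ‖HermForm.toForm R‖ ^ 2 ↔
        ∃ u ∈ HermForm.Form11 E,
          HermForm.toForm R =
            HermForm.wedge (HermForm.pullE V E 2 u) (HermForm.omegaV V E))) ∧
    -- `Λ_h R` is the first Chern form, pulled back, and has the same norm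
    (HermForm.lefschetzAdj (HermForm.hE V E) 2 (HermForm.toForm R) =
        HermForm.pullV V E 2 (HermForm.chernOne R) ∧
      ‖HermForm.chernOne R‖ ^ 2 =
        ‖HermForm.lefschetzAdj (HermForm.hE V E) 2 (HermForm.toForm R)‖ ^ 2) ∧
    -- the estimate for `Λ_h R`, with its equality case
    (‖HermForm.lefschetzAdj (HermForm.hE V E) 2 (HermForm.toForm R)‖ ^ 2 ≤
        (Module.finrank ℂ E : ℝ) * ‖HermForm.toForm R‖ ^ 2 ∧
      (‖HermForm.lefschetzAdj (HermForm.hE V E) 2 (HermForm.toForm R)‖ ^ 2 =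
          (Module.finrank ℂ E : ℝ) * ‖HermForm.toForm R‖ ^ 2 ↔
        ∃ v ∈ HermForm.Form11 V,
          HermForm.toForm R =
            HermForm.wedge (HermForm.pullV V E 2 v) (HermForm.hE V E))) := by
  refine ⟨?_, ⟨HermForm.lefschetzAdj_hE_toForm R, ?_⟩, ?_⟩
  · obtain ⟨u, hu, hRu⟩ := HermForm.exists_lefschetzAdj_omegaV_toForm R
    have h := HermForm.norm_adjoint_sq_le (HermForm.lefschetz (HermForm.omegaV V E) 2)
      ((HermForm.Form11 E).map (HermForm.pullE V E 2)) (Module.finrank ℂ V) ?_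
      (HermForm.toForm R) ⟨u, hu, hRu.symm⟩ fun h0 => ?_
    · refine ⟨h.1, h.2.trans ?_⟩
      simp only [Submodule.mem_map, exists_exists_and_eq_and]
      rfl
    -- `L* L = n` on `S` is the contraction formula with β = ω, since `⟨ω, ω⟩ = n`.
    · rintro _ ⟨s, -, rfl⟩
      refine (HermForm.lefschetzAdj_omegaV_wedge s (HermForm.metricForm V)).trans ?_
      rw [HermForm.inner_metricForm_self]
    · have := Module.finrank_zero_iff.mp h0
      exact HermForm.toForm_eq_zero_of_subsingleton_left R
  · rw [HermForm.lefschetzAdj_hE_toForm, ← inner_self_eq_norm_sq (𝕜 := ℂ),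
      ← inner_self_eq_norm_sq (𝕜 := ℂ), HermForm.inner_pullV]
  · have h := HermForm.norm_adjoint_sq_le (HermForm.lefschetz (HermForm.hE V E) 2)
      ((HermForm.Form11 V).map (HermForm.pullV V E 2)) (Module.finrank ℂ E) ?_
      (HermForm.toForm R)
      ⟨HermForm.chernOne R, HermForm.chernOne_mem R, (HermForm.lefschetzAdj_hE_toForm R).symm⟩
      fun h0 => ?_
    · refine ⟨h.1, h.2.trans ?_⟩
      simp only [Submodule.mem_map, exists_exists_and_eq_and]
      rfl
    · rintro _ ⟨s, -, rfl⟩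
      refine (HermForm.lefschetzAdj_hE_wedge s (HermForm.metricForm E)).trans ?_
      rw [HermForm.inner_metricForm_self]
    · have := Module.finrank_zero_iff.mp h0
      exact HermForm.toForm_eq_zero_of_subsingleton_right R
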